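/- Let $\mathbb{K}$ be a field of characteristic zero, $G$ an abelian group (written additively) and $\varepsilon:G\times G\to\mathbb{K}^\times$ an anti-symmetric bicharacter, i.e. $\varepsilon(g,h)\varepsilon(h,g)=1$, $\varepsilon(g,h+k)=\varepsilon(g,h)\varepsilon(g,k)$ and $\varepsilon(g+h,k)=\varepsilon(g,k)\varepsilon(h,k)$. Let $L=\bigoplus_{g\in G}L_g$ be a finite-dimensional color Lie algebra over $\mathbb{K}$: a $G$-graded vector space with a bilinear bracket such that $[L_g,L_h]\subseteq L_{g+h}$ and, for all homogeneous $a,b,c$ of degrees $|a|,|b|,|c|$, $$[a,b]=-\varepsilon(|a|,|b|)[b,a],\qquad \varepsilon(|c|,|a|)[a,[b,c]]+\varepsilon(|a|,|b|)[b,[c,a]]+\varepsilon(|b|,|c|)[c,[a,b]]=0 .$$ Let $\omega:L\times L\to\mathbb{K}$ be a scalar graded 2-cocycle of degree zero: a bilinear form with $\omega(L_g,L_h)=0$ if $g+h\neq0$ and, for all homogeneous $a,b,c$, $$\omega(a,b)=-\varepsilon(|a|,|b|)\,\omega(b,a),\qquad \varepsilon(|c|,|a|)\,\omega(a,[b,c])+\varepsilon(|a|,|b|)\,\omega(b,[c,a])+\varepsilon(|b|,|c|)\,\omega(c,[a,b])=0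 .$$ Let $U_\omega(L)$ be the quotient of the tensor algebra $T(L)$ by the two-sided ideal generated by the elements $a\otimes b-\varepsilon(|a|,|b|)\,b\otimes a-[a,b]-\omega(a,b)$ with $a,b\in L$ homogeneous, and let $U_\omega(L)_g$ be the image of the span of the tensors $a_1\otimes\cdots\otimes a_n$ ($n\ge0$) with $a_i\in L_{g_i}$ and $g_1+\cdots+g_n=g$. Then $U_\omega(L)=\bigoplus_{g\in G}U_\omega(L)_g$ is a $G$-graded algebra, and it is (two-sided) Noetherian: it is graded left and graded right Noetherian, i.e. every ascending chain of homogeneous left ideals, and every ascending chain of homogeneous right ideals, is stationary; moreover it is left and right Noetherian as an ungraded ring. -/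

import Mathlib

/-- An anti-symmetric bicharacter `ε : G × G → Kˣ` on an (additively written) abelian group. -/
structure IsAntiBicharacter {K G : Type*} [Field K] [AddCommGroup G] (ε : G → G → Kˣ) : Prop where
  mul_swap : ∀ g h, ε g h * ε h g = 1
  add_right : ∀ g h k, ε g (h + k) = ε g h * ε g k
  add_left : ∀ g h k, ε (g + h) k = ε g k * ε h k

/-- The structure of a `G`-graded `ε`-Lie algebra (color Lie algebra) on the `K`-vector space `L`:
a decomposition `L = ⨁ L_g` and a bilinear bracket that is graded, `ε`-skew-symmetric and
satisfies the `ε`-Jacobi identity. -/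
structure ColorLieAlgebra {K G : Type*} [Field K] [AddCommGroup G] [DecidableEq G]
    (ε : G → G → Kˣ) (L : Type*) [AddCommGroup L] [Module K L] where
  /-- the homogeneous component of degree `g` -/
  comp : G → Submodule K L
  isInternal : DirectSum.IsInternal comp
  bracket : L →ₗ[K] L →ₗ[K] L
  bracket_mem : ∀ {g h : G} {a b : L}, a ∈ comp g → b ∈ comp h → bracket a b ∈ comp (g + h)
  skew : ∀ {g h : G} {a b : L}, a ∈ comp g → b ∈ comp h →
    bracket a b = -((ε g h : K) • bracket b a)
  jacobi : ∀ {g h k : G} {a b c : L}, a ∈ comp g → b ∈ comp h → c ∈ comp k →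
    (ε k g : K) • bracket a (bracket b c) + (ε g h : K) • bracket b (bracket c a)
      + (ε h k : K) • bracket c (bracket a b) = 0

/-- Scalar graded 2-cocycles (of degree zero) of a color Lie algebra: `ε`-skew-symmetric bilinear
forms `L × L → K`, of degree zero for the grading of `K` concentrated in degree `0`, that satisfy
the cocycle identity. -/
structure ColorTwoCocycle {K G : Type*} [Field K] [AddCommGroup G] [DecidableEq G]
    {ε : G → G → Kˣ} {L : Type*} [AddCommGroup L] [Module K L] (𝔏 : ColorLieAlgebra ε L) where
  form : L →ₗ[K] L →ₗ[K] K
  degree_zero : ∀ {g h : G} {a b : L}, a ∈ 𝔏.comp g → b ∈ 𝔏.comp h → g + h ≠ 0 → form a b = 0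
  skew : ∀ {g h : G} {a b : L}, a ∈ 𝔏.comp g → b ∈ 𝔏.comp h →
    form a b = -((ε g h : K) * form b a)
  cocycle : ∀ {g h k : G} {a b c : L}, a ∈ 𝔏.comp g → b ∈ 𝔏.comp h → c ∈ 𝔏.comp k →
    (ε k g : K) * form a (𝔏.bracket b c) + (ε g h : K) * form b (𝔏.bracket c a)
      + (ε h k : K) * form c (𝔏.bracket a b) = 0

section GeneralizedEnveloping

variable {K G : Type*} [Field K] [AddCommGroup G] [DecidableEq G] {ε : G → G → Kˣ}
  {L : Type*} [AddCommGroup L] [Module K L]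

/-- The relations `a ⊗ b - ε(|a|,|b|) b ⊗ a - [a,b] - ω(a,b) = 0` for homogeneous `a`, `b`. -/
inductive GenEnvelopingRel (𝔏 : ColorLieAlgebra ε L) (ω : ColorTwoCocycle 𝔏) :
    TensorAlgebra K L → TensorAlgebra K L → Prop
  | mk {g h : G} {a b : L} (ha : a ∈ 𝔏.comp g) (hb : b ∈ 𝔏.comp h) :
      GenEnvelopingRel 𝔏 ω
        (TensorAlgebra.ι K a * TensorAlgebra.ι K b
          - (ε g h : K) • (TensorAlgebra.ι K b * TensorAlgebra.ι K a)
          - TensorAlgebra.ι K (𝔏.bracket a b)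
          - algebraMap K (TensorAlgebra K L) (ω.form a b))
        0

/-- The generalized enveloping algebra `U_ω(L)`: the quotient of the tensor algebra of `L` by the
two-sided ideal generated by the elements above. -/
abbrev GenEnveloping (𝔏 : ColorLieAlgebra ε L) (ω : ColorTwoCocycle 𝔏) : Type _ :=
  RingQuot (GenEnvelopingRel 𝔏 ω)

/-- The component of degree `g` of the tensor algebra of `L` for its `G`-grading: it is spanned by
the tensors `a₁ ⊗ ⋯ ⊗ aₙ`, `n ≥ 0`, with `aᵢ ∈ L_{gᵢ}` and `g₁ + ⋯ + gₙ = g`. -/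
def tensorGrading (𝔏 : ColorLieAlgebra ε L) (g : G) : Submodule K (TensorAlgebra K L) :=
  Submodule.span K {t | ∃ l : List (G × L), (∀ p ∈ l, p.2 ∈ 𝔏.comp p.1) ∧
    (l.map Prod.fst).sum = g ∧ t = (l.map fun p => TensorAlgebra.ι K p.2).prod}

/-- The component of degree `g` of `U_ω(L)`: the image of that of the tensor algebra. -/
def genEnvelopingGrading (𝔏 : ColorLieAlgebra ε L) (ω : ColorTwoCocycle 𝔏) (g : G) :
    Submodule K (GenEnveloping 𝔏 ω) :=
  (tensorGrading 𝔏 g).map (RingQuot.mkAlgHom K (GenEnvelopingRel 𝔏 ω)).toLinearMap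

end GeneralizedEnveloping

/-- Every ascending chain of homogeneous left ideals of the graded algebra `A` is stationary. -/
def IsGradedLeftNoetherian {K G A : Type*} [Field K] [AddCommGroup G] [DecidableEq G] [Ring A]
    [Algebra K A] (𝒜 : G → Submodule K A) [GradedAlgebra 𝒜] : Prop :=
  ∀ I : ℕ →o Submodule A A, (∀ n, (I n).IsHomogeneous 𝒜) → ∃ n, ∀ m, n ≤ m → I n = I m

/-- Every ascending chain of homogeneous right ideals of the graded algebra `A` is stationary. -/
def IsGradedRightNoetherian {K G A : Type*} [Field K] [AddCommGroup G] [DecidableEq G] [Ring A]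
    [Algebra K A] (𝒜 : G → Submodule K A) [GradedAlgebra 𝒜] : Prop :=
  ∀ I : ℕ →o Submodule Aᵐᵒᵖ A, (∀ n, (I n).IsHomogeneous 𝒜) → ∃ n, ∀ m, n ≤ m → I n = I m

/-! A homogeneous basis `x` of `L` generates `U_ω(L)`, and the defining relations say that `x i` and
`x j` commute up to a nonzero scalar and an element of the span of `1` and the `x k`. Hence standard
monomials span and multiply like commutative ones, up to nonzero scalars and shorter words. Gröbner
division in the degree lexicographic order (`IsSkewFamily.le_of_leadingExponents`) and Dickson's
lemma then make every left ideal finitely generated. Only spanning is used: no PBW theorem is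
needed.

The relations pass to the opposite algebra, which gives the right-hand statement, and the graded
versions follow by forgetting homogeneity. For the grading, `ω` having degree zero makes the
relations homogeneous, so the universal property yields `decomposeHom`, inverse to the sum map. -/

section SkewWords

/-! ### Words and standard monomials in a skew-commuting family -/

variable {K A σ : Type*} [Field K] [Ring A] [Algebra K A]

/-- The product in `A` of a word in the family `x`. -/
def wordProd (x : σ → A) (l : List σ) : A := (l.map x).prod

theorem wordProd_cons (x : σ → A) (i : σ) (l : List σ) :
    wordProd x (i :: l) = x i * wordProd x l := by
  simp [wordProd]

theorem wordProd_append (x : σ → A) (l l' : List σ) :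
    wordProd x (l ++ l') = wordProd x l * wordProd x l' := by
  simp [wordProd]

variable (K) in
/-- The span of the words of length less than `d` in the family `x`. -/
def shortWords (x : σ → A) (d : ℕ) : Submodule K A :=
  Submodule.span K {a | ∃ l : List σ, l.length < d ∧ wordProd x l = a}

theorem wordProd_mem_shortWords (x : σ → A) {l : List σ} {d : ℕ} (h : l.length < d) :
    wordProd x l ∈ shortWords K x d :=
  Submodule.subset_span ⟨l, h, rfl⟩

theorem shortWords_mono (x : σ → A) {d e : ℕ} (h : d ≤ e) :
    shortWords K x d ≤ shortWords K x e :=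
  Submodule.span_mono fun _ ⟨l, hl, e⟩ => ⟨l, hl.trans_le h, e⟩

theorem wordProd_mul_mem_shortWords (x : σ → A) (l : List σ) {d : ℕ} {f : A}
    (hf : f ∈ shortWords K x d) : wordProd x l * f ∈ shortWords K x (l.length + d) := by
  induction hf using Submodule.span_induction with
  | mem f hf =>
    obtain ⟨l', hl', rfl⟩ := hf
    rw [← wordProd_append]
    exact wordProd_mem_shortWords x (by simpa using hl')
  | zero => simp
  | add f g _ _ hf hg => rw [mul_add]; exact add_mem hf hg
  | smul c f _ hf => rw [mul_smul_comm]; exact Submodule.smul_mem _ c hf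

variable (K) in
/-- The members of the family `x` commute up to nonzero scalars and linear terms. -/
def IsSkewFamily (x : σ → A) : Prop :=
  ∀ i j, ∃ u : K, u ≠ 0 ∧
    x i * x j - u • (x j * x i) ∈ Submodule.span K (insert 1 (Set.range x))

/-- Adjacent swaps generate all permutations, and each costs only a nonzero scalar and shorter
words. So the arbitrary order chosen by `Multiset.toList` in `stdMonomial` is harmless. -/
theorem IsSkewFamily.exists_wordProd_sub_smul_mem {x : σ → A} (hx : IsSkewFamily K x)
    {l l' : List σ} (h : l.Perm l') :
    ∃ u : K, u ≠ 0 ∧ wordProd x l - u • wordProd x l' ∈ shortWords K x l.length := by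
  induction h with
  | nil => exact ⟨1, one_ne_zero, by simp⟩
  | cons i _ ih =>
    obtain ⟨u, hu, h⟩ := ih
    refine ⟨u, hu, ?_⟩
    have := wordProd_mul_mem_shortWords x [i] h
    simpa [wordProd_cons, mul_sub, wordProd, add_comm] using this
  | swap i j l =>
    obtain ⟨u, hu, h⟩ := hx j i
    refine ⟨u, hu, ?_⟩
    have key : ∀ f ∈ Submodule.span K (insert 1 (Set.range x)),
        f * wordProd x l ∈ shortWords K x (j :: i :: l).length := by
      intro f hf
      induction hf using Submodule.span_induction with
      | mem f hf =>
        obtain rfl | ⟨k, rfl⟩ := hf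
        · rw [one_mul]
          exact wordProd_mem_shortWords x (by simp)
        · rw [← wordProd_cons]
          exact wordProd_mem_shortWords x (by simp)
      | zero => simp
      | add f g _ _ hf hg => rw [add_mul]; exact add_mem hf hg
      | smul c f _ hf => rw [smul_mul_assoc]; exact Submodule.smul_mem _ c hf
    simpa [wordProd_cons, sub_mul, mul_assoc] using key _ h
  | trans h₁ _ ih₁ ih₂ =>
    obtain ⟨u, hu, h⟩ := ih₁
    obtain ⟨v, hv, h'⟩ := ih₂
    refine ⟨u * v, mul_ne_zero hu hv, ?_⟩
    rw [← h₁.length_eq] at h'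
    have := add_mem h (Submodule.smul_mem _ u h')
    rwa [smul_sub, smul_smul, sub_add_sub_cancel] at this

/-- The standard monomial with exponent vector `α` in the family `x`. -/
noncomputable def stdMonomial (x : σ → A) (α : σ →₀ ℕ) : A :=
  wordProd x (Finsupp.toMultiset α).toList

theorem length_toList_toMultiset (α : σ →₀ ℕ) :
    (Finsupp.toMultiset α).toList.length = α.degree := by
  rw [Multiset.length_toList, Finsupp.card_toMultiset]
  rfl

theorem IsSkewFamily.exists_wordProd_sub_stdMonomial_mem {x : σ → A} (hx : IsSkewFamily K x)
    (l : List σ) : ∃ α : σ →₀ ℕ, α.degree = l.length ∧ ∃ u : K,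
      wordProd x l - u • stdMonomial x α ∈ shortWords K x l.length := by
  classical
  have hp : l.Perm (Finsupp.toMultiset (Multiset.toFinsupp (l : Multiset σ))).toList := by
    rw [← Multiset.coe_eq_coe]
    simp
  obtain ⟨u, -, h⟩ := hx.exists_wordProd_sub_smul_mem hp
  exact ⟨_, by rw [← length_toList_toMultiset, hp.length_eq], u, h⟩

theorem IsSkewFamily.shortWords_le {x : σ → A} (hx : IsSkewFamily K x) (d : ℕ) :
    shortWords K x d ≤ Submodule.span K (stdMonomial x '' {α | α.degree < d}) := by
  induction d with
  | zero => simp [shortWords]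
  | succ d ih =>
    refine Submodule.span_le.2 ?_
    rintro _ ⟨l, hl, rfl⟩
    obtain ⟨α, hα, u, h⟩ := hx.exists_wordProd_sub_stdMonomial_mem l
    have h₁ := Submodule.span_mono (Set.image_mono fun _ h => Nat.lt_succ_of_lt h)
      (ih (shortWords_mono x (Nat.lt_succ_iff.1 hl) h))
    have h₂ : stdMonomial x α ∈ Submodule.span K (stdMonomial x '' {α | α.degree < d + 1}) :=
      Submodule.subset_span ⟨α, hα.trans_lt hl, rfl⟩
    rw [← sub_add_cancel (wordProd x l) (u • stdMonomial x α)]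
    exact add_mem h₁ (Submodule.smul_mem _ u h₂)

theorem IsSkewFamily.exists_stdMonomial_mul_sub_mem {x : σ → A} (hx : IsSkewFamily K x)
    (α β : σ →₀ ℕ) : ∃ u : K, u ≠ 0 ∧
      stdMonomial x α * stdMonomial x β - u • stdMonomial x (α + β) ∈
        shortWords K x (α + β).degree := by
  have hp : ((Finsupp.toMultiset α).toList ++ (Finsupp.toMultiset β).toList).Perm
      (Finsupp.toMultiset (α + β)).toList := by
    rw [← Multiset.coe_eq_coe, ← Multiset.coe_add]
    simp
  obtain ⟨u, hu, h⟩ := hx.exists_wordProd_sub_smul_mem hp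
  refine ⟨u, hu, ?_⟩
  rwa [hp.length_eq, length_toList_toMultiset, wordProd_append] at h

theorem IsSkewFamily.span_stdMonomial {x : σ → A} (hx : IsSkewFamily K x)
    (hgen : Algebra.adjoin K (Set.range x) = ⊤) :
    Submodule.span K (Set.range (stdMonomial x)) = ⊤ := by
  rw [eq_top_iff, ← Algebra.top_toSubmodule, ← hgen, Algebra.adjoin_eq_span, Submodule.span_le]
  intro a ha
  obtain ⟨l, rfl⟩ : ∃ l : List σ, wordProd x l = a := by
    induction ha using Submonoid.closure_induction with
    | mem a ha =>
      obtain ⟨i, rfl⟩ := ha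
      exact ⟨[i], by simp [wordProd]⟩
    | one => exact ⟨[], by simp [wordProd]⟩
    | mul a b _ _ ha hb =>
      obtain ⟨l, rfl⟩ := ha
      obtain ⟨l', rfl⟩ := hb
      exact ⟨l ++ l', wordProd_append x l l'⟩
  exact Submodule.span_mono (Set.image_subset_range _ _)
    (hx.shortWords_le _ (wordProd_mem_shortWords x (Nat.lt_succ_self _)))

/-! ### Leading exponents and left Noetherianity -/

section Noetherian

open MonomialOrder

variable [LinearOrder σ] [WellFoundedGT σ]

variable (K) in
/-- The span of the standard monomials below `x ^ α` in the degree lexicographic order. -/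
noncomputable def lowerTerms (x : σ → A) (α : σ →₀ ℕ) : Submodule K A :=
  Submodule.span K (stdMonomial x '' {β | β ≺[degLex] α})

theorem lowerTerms_mono (x : σ → A) {α β : σ →₀ ℕ} (h : α ≼[degLex] β) :
    lowerTerms K x α ≤ lowerTerms K x β :=
  Submodule.span_mono (Set.image_mono fun _ hγ => lt_of_lt_of_le hγ h)

theorem stdMonomial_mem_lowerTerms (x : σ → A) {α β : σ →₀ ℕ} (h : α ≺[degLex] β) :
    stdMonomial x α ∈ lowerTerms K x β :=
  Submodule.subset_span ⟨α, h, rfl⟩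

theorem IsSkewFamily.shortWords_le_lowerTerms {x : σ → A} (hx : IsSkewFamily K x)
    (α : σ →₀ ℕ) : shortWords K x α.degree ≤ lowerTerms K x α :=
  (hx.shortWords_le _).trans <| Submodule.span_mono <| Set.image_mono fun _ hβ =>
    degLex_lt_iff.2 (Finsupp.DegLex.lt_iff.2 (Or.inl hβ))

theorem IsSkewFamily.stdMonomial_mul_mem_lowerTerms {x : σ → A} (hx : IsSkewFamily K x)
    (α β : σ →₀ ℕ) {f : A} (hf : f ∈ lowerTerms K x β) :
    stdMonomial x α * f ∈ lowerTerms K x (α + β) := by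
  induction hf using Submodule.span_induction with
  | mem f hf =>
    obtain ⟨γ, hγ, rfl⟩ := hf
    have hlt : (α + γ) ≺[degLex] (α + β) := by
      rw [map_add, map_add]
      exact add_lt_add_right hγ _
    obtain ⟨u, -, h⟩ := hx.exists_stdMonomial_mul_sub_mem α γ
    have h₁ := lowerTerms_mono x hlt.le (hx.shortWords_le_lowerTerms _ h)
    simpa using add_mem h₁ (Submodule.smul_mem _ u (stdMonomial_mem_lowerTerms (K := K) x hlt))
  | zero => simp
  | add f g _ _ hf hg => rw [mul_add]; exact add_mem hf hg
  | smul c f _ hf => rw [mul_smul_comm]; exact Submodule.smul_mem _ c hf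

variable (K) in
/-- The exponent vectors of the leading monomials of the elements of a left ideal. -/
def leadingExponents (x : σ → A) (I : Ideal A) : Set (σ →₀ ℕ) :=
  {α | ∃ f ∈ I, f - stdMonomial x α ∈ lowerTerms K x α}

/-- Standard monomials may be dependent, so leading terms are not unique. Existence suffices, and `c
= 0` is allowed because leading terms may cancel in a sum. -/
theorem exists_leading_of_mem_span (x : σ → A) (S : Set (σ →₀ ℕ)) {f : A}
    (hf : f ∈ Submodule.span K (stdMonomial x '' S)) :
    f = 0 ∨ ∃ γ ∈ S, ∃ c : K, f - c • stdMonomial x γ ∈ lowerTerms K x γ := by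
  have hlow : ∀ {γ δ : σ →₀ ℕ} {c d : K} {f g : A}, δ ≺[degLex] γ →
      f - c • stdMonomial x γ ∈ lowerTerms K x γ →
      g - d • stdMonomial x δ ∈ lowerTerms K x δ →
      f + g - c • stdMonomial x γ ∈ lowerTerms K x γ := by
    intro γ δ c d f g hlt hc hd
    have := add_mem (add_mem hc (lowerTerms_mono x hlt.le hd))
      (Submodule.smul_mem _ d (stdMonomial_mem_lowerTerms (K := K) x hlt))
    convert this using 1
    abel
  induction hf using Submodule.span_induction with
  | mem f hf =>
    obtain ⟨γ, hγ, rfl⟩ := hf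
    exact Or.inr ⟨γ, hγ, 1, by simp⟩
  | zero => exact Or.inl rfl
  | add f g _ _ hf hg =>
    obtain rfl | ⟨γ, hγ, c, hc⟩ := hf
    · simpa using hg
    obtain rfl | ⟨δ, hδ, d, hd⟩ := hg
    · exact Or.inr ⟨γ, hγ, c, by simpa using hc⟩
    rcases lt_trichotomy (degLex.toSyn γ) (degLex.toSyn δ) with hlt | heq | hlt
    · exact Or.inr ⟨δ, hδ, d, by rw [add_comm]; exact hlow hlt hd hc⟩
    · obtain rfl := degLex.toSyn.injective heq
      refine Or.inr ⟨γ, hγ, c + d, ?_⟩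
      rw [add_smul, add_sub_add_comm]
      exact add_mem hc hd
    · exact Or.inr ⟨γ, hγ, c, hlow hlt hc hd⟩
  | smul a f _ hf =>
    obtain rfl | ⟨γ, hγ, c, hc⟩ := hf
    · simp
    · refine Or.inr ⟨γ, hγ, a * c, ?_⟩
      rw [mul_smul, ← smul_sub]
      exact Submodule.smul_mem _ a hc

/-- A left ideal `J ≤ I` contains `I` if every leading exponent of `I` is divisible by one of
`J`. -/
theorem IsSkewFamily.le_of_leadingExponents {x : σ → A} (hx : IsSkewFamily K x)
    (hgen : Algebra.adjoin K (Set.range x) = ⊤) {I J : Ideal A} (hJI : J ≤ I)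
    (h : ∀ α ∈ leadingExponents K x I, ∃ β ∈ leadingExponents K x J, β ≤ α) : I ≤ J := by
  -- Division algorithm, as a well-founded induction on the exponent `γ`.
  have key : ∀ (s : degLex (σ := σ).syn) (γ : σ →₀ ℕ), degLex.toSyn γ = s → ∀ c : K, ∀ f ∈ I,
      f - c • stdMonomial x γ ∈ lowerTerms K x γ → f ∈ J := by
    intro s
    induction s using WellFoundedLT.induction with
    | ind s ih =>
    rintro γ rfl c f hf hfγ
    have lower : ∀ f ∈ I, f ∈ lowerTerms K x γ → f ∈ J := by
      intro f hf hfγ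
      obtain rfl | ⟨δ, hδ, d, hd⟩ := exists_leading_of_mem_span x _ hfγ
      · exact J.zero_mem
      · exact ih _ hδ δ rfl d f hf hd
    by_cases hc : c = 0
    · subst hc
      exact lower f hf (by simpa using hfγ)
    have hγI : γ ∈ leadingExponents K x I := by
      refine ⟨algebraMap K A c⁻¹ * f, I.mul_mem_left _ hf, ?_⟩
      have := Submodule.smul_mem _ c⁻¹ hfγ
      rwa [smul_sub, smul_smul, inv_mul_cancel₀ hc, one_smul, Algebra.smul_def] at this
    obtain ⟨β, ⟨g, hg, hgβ⟩, hβ⟩ := h γ hγI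
    obtain ⟨δ, rfl⟩ : ∃ δ, γ = δ + β := ⟨γ - β, (tsub_add_cancel_of_le hβ).symm⟩
    obtain ⟨u, hu, hmul⟩ := hx.exists_stdMonomial_mul_sub_mem δ β
    have h₁ := hx.stdMonomial_mul_mem_lowerTerms δ β hgβ
    have h₂ := add_mem h₁ (hx.shortWords_le_lowerTerms _ hmul)
    rw [mul_sub, sub_add_sub_cancel] at h₂
    -- `x^δ * g` has leading term `u • x^γ`, so the factor `c * u⁻¹` cancels that of `f`.
    have h₃ := sub_mem hfγ (Submodule.smul_mem _ (c * u⁻¹) h₂)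
    rw [smul_sub, smul_smul, mul_assoc, inv_mul_cancel₀ hu, mul_one,
      sub_sub_sub_cancel_right, Algebra.smul_def (c * u⁻¹)] at h₃
    have h₄ : algebraMap K A (c * u⁻¹) * (stdMonomial x δ * g) ∈ J :=
      J.mul_mem_left _ (J.mul_mem_left _ hg)
    have h₅ := lower _ (I.sub_mem hf (hJI h₄)) h₃
    simpa using J.add_mem h₅ h₄
  intro f hf
  have hf' : f ∈ Submodule.span K (stdMonomial x '' Set.univ) := by
    rw [Set.image_univ, hx.span_stdMonomial hgen]
    trivial
  obtain rfl | ⟨γ, -, c, hc⟩ := exists_leading_of_mem_span x _ hf'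
  · exact J.zero_mem
  · exact key _ γ rfl c f hf hc

/-- Dickson's lemma: the minimal leading exponents form an antichain in a well-quasi-order, hence
are finitely many, and one element of `I` for each generates `I`. -/
theorem IsSkewFamily.isNoetherianRing [Finite σ] {x : σ → A} (hx : IsSkewFamily K x)
    (hgen : Algebra.adjoin K (Set.range x) = ⊤) : IsNoetherianRing A := by
  refine isNoetherianRing_iff.2 ⟨fun I => ?_⟩
  have hpwo := Set.isPWO_of_wellQuasiOrderedLE (leadingExponents K x I)
  have hfin : {α | Minimal (· ∈ leadingExponents K x I) α}.Finite :=
    (setOfPred_minimal_antichain _).finite_of_partiallyWellOrderedOn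
      (hpwo.mono (setOfPred_minimal_subset _))
  choose! g hgI hg using fun α (hα : α ∈ leadingExponents K x I) => hα
  let S := g '' {α | Minimal (· ∈ leadingExponents K x I) α}
  have hJI : Ideal.span S ≤ I := by
    rw [Ideal.span_le]
    rintro _ ⟨α, hα, rfl⟩
    exact hgI α hα.prop
  have : I = Ideal.span S := by
    refine le_antisymm (hx.le_of_leadingExponents hgen hJI fun α hα => ?_) hJI
    obtain ⟨β, hβα, hβ⟩ := hpwo.exists_le_minimal hα
    exact ⟨β, ⟨g β, Ideal.subset_span ⟨β, hβ, rfl⟩, hg β hβ.prop⟩, hβα⟩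
  rw [this]
  exact Submodule.fg_span (hfin.image g)

end Noetherian

end SkewWords

/-! ### A homogeneous relation lifted to the external direct sum -/

namespace DirectSum

variable {K A G : Type*} [Field K] [Ring A] [Algebra K A] [DecidableEq G]
  (𝒜 : G → Submodule K A)

theorem lof_congr {g h : G} (e : g = h) {a b : A} (ha : a ∈ 𝒜 g) (hb : b ∈ 𝒜 h)
    (hab : a = b) :
    lof K G (fun g => 𝒜 g) g ⟨a, ha⟩ = lof K G (fun g => 𝒜 g) h ⟨b, hb⟩ := by
  subst e hab
  rfl

theorem lof_mul_lof_eq [AddCommGroup G] [SetLike.GradedMonoid 𝒜] {g h : G} {a b c : A} (ha : a ∈ 𝒜 g)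
    (hb : b ∈ 𝒜 h) (hc : c ∈ 𝒜 (g + h)) (u w : K) (hw : g + h ≠ 0 → w = 0)
    (hrel : a * b = u • (b * a) + c + algebraMap K A w) :
    lof K G (fun g => 𝒜 g) g ⟨a, ha⟩ * lof K G (fun g => 𝒜 g) h ⟨b, hb⟩ =
      u • (lof K G (fun g => 𝒜 g) h ⟨b, hb⟩ * lof K G (fun g => 𝒜 g) g ⟨a, ha⟩)
        + lof K G (fun g => 𝒜 g) (g + h) ⟨c, hc⟩ + algebraMap K (⨁ g, 𝒜 g) w := by
  have hab := SetLike.mul_mem_graded ha hb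
  have hba := SetLike.mul_mem_graded hb ha
  rw [add_comm h g] at hba
  -- The scalar lives in degree `0`; it fits in degree `g + h` because it vanishes when `g + h ≠ 0`.
  obtain ⟨hw', ew⟩ : ∃ h' : algebraMap K A w ∈ 𝒜 (g + h),
      algebraMap K (⨁ g, 𝒜 g) w = lof K G (fun g => 𝒜 g) (g + h) ⟨_, h'⟩ := by
    by_cases e : g + h = 0
    · exact ⟨e ▸ SetLike.algebraMap_mem_graded _ _,
        lof_congr 𝒜 e.symm (SetLike.algebraMap_mem_graded _ _) _ rfl⟩
    · obtain rfl := hw e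
      have h₀ : algebraMap K A 0 ∈ 𝒜 (g + h) := by simp
      refine ⟨h₀, ?_⟩
      rw [map_zero]
      have hz : (⟨algebraMap K A 0, h₀⟩ : 𝒜 (g + h)) = 0 := by ext; simp
      rw [hz, map_zero]
  have eab : lof K G (fun g => 𝒜 g) g ⟨a, ha⟩ * lof K G (fun g => 𝒜 g) h ⟨b, hb⟩ =
      lof K G (fun g => 𝒜 g) (g + h) ⟨_, hab⟩ := of_mul_of _ _
  have eba : lof K G (fun g => 𝒜 g) h ⟨b, hb⟩ * lof K G (fun g => 𝒜 g) g ⟨a, ha⟩ =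
      lof K G (fun g => 𝒜 g) (g + h) ⟨_, hba⟩ :=
    (of_mul_of _ _).trans (lof_congr 𝒜 (add_comm h g) _ hba rfl)
  rw [eab, eba, ew, ← map_smul, ← map_add, ← map_add]
  exact congrArg _ (Subtype.ext hrel)

end DirectSum

theorem map_sub_sub_sub_eq {R S : Type*} [Ring R] [Ring S] (f : R →+* S) {p q r s : R}
    (h : f p = f q + f r + f s) : f (p - q - r - s) = f 0 := by
  simp [h, sub_sub]

/-! ### Passage to the opposite ring and to graded chains -/

section Opposite

variable {K A σ : Type*} [Field K] [Ring A] [Algebra K A]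

open MulOpposite in
theorem IsSkewFamily.op {x : σ → A} (hx : IsSkewFamily K x) :
    IsSkewFamily K fun i => MulOpposite.op (x i) := by
  intro i j
  -- The indices are exchanged since `op` reverses products.
  obtain ⟨u, hu, h⟩ := hx j i
  refine ⟨u, hu, ?_⟩
  have := Submodule.mem_map_of_mem (f := (opLinearEquiv K : A ≃ₗ[K] Aᵐᵒᵖ).toLinearMap) h
  rw [Submodule.map_span, Set.image_insert_eq, ← Set.range_comp] at this
  simpa [Function.comp_def] using this

theorem Algebra.adjoin_range_op_eq_top {x : σ → A}
    (hgen : Algebra.adjoin K (Set.range x) = ⊤) :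
    Algebra.adjoin K (Set.range fun i => MulOpposite.op (x i)) = ⊤ := by
  refine Algebra.eq_top_iff.2 fun a => ?_
  obtain ⟨b, rfl⟩ := MulOpposite.op_surjective a
  have hb : b ∈ Algebra.adjoin K (Set.range x) := hgen ▸ Algebra.mem_top
  induction hb using Algebra.adjoin_induction with
  | mem b hb =>
    obtain ⟨i, rfl⟩ := hb
    exact Algebra.subset_adjoin ⟨i, rfl⟩
  | algebraMap c => exact Subalgebra.algebraMap_mem _ c
  | add b c _ _ hb hc => exact add_mem hb hc
  | mul b c _ _ hb hc => exact mul_mem hc hb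

/-- A ring that is right Noetherian is Noetherian as a module over its opposite. -/
theorem isNoetherian_mulOpposite_of_isNoetherianRing (R : Type*) [Ring R]
    [h : IsNoetherianRing Rᵐᵒᵖ] : IsNoetherian Rᵐᵒᵖ R :=
  let e : Rᵐᵒᵖ ≃ₗ[Rᵐᵒᵖ] R :=
    { (MulOpposite.opAddEquiv (α := R)).symm with
      map_smul' := fun _ _ => rfl }
  isNoetherian_of_linearEquiv e

variable {G : Type*} [AddCommGroup G] [DecidableEq G]

theorem IsGradedLeftNoetherian.of_isNoetherianRing (𝒜 : G → Submodule K A) [GradedAlgebra 𝒜]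
    [IsNoetherianRing A] : IsGradedLeftNoetherian 𝒜 := fun I _ =>
  monotone_stabilizes_iff_noetherian.2 ‹_› I

theorem IsGradedRightNoetherian.of_isNoetherianRing_mulOpposite (𝒜 : G → Submodule K A)
    [GradedAlgebra 𝒜] [IsNoetherianRing Aᵐᵒᵖ] : IsGradedRightNoetherian 𝒜 := fun I _ =>
  monotone_stabilizes_iff_noetherian.2 (isNoetherian_mulOpposite_of_isNoetherianRing A) I

end Opposite

/-! ### Generators and grading of `U_ω(L)` -/

namespace GenEnveloping

variable {K G : Type*} [Field K] [AddCommGroup G] [DecidableEq G] {ε : G → G → Kˣ}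
  {L : Type*} [AddCommGroup L] [Module K L] (𝔏 : ColorLieAlgebra ε L) (ω : ColorTwoCocycle 𝔏)

/-- The canonical map from `L` to its generalized enveloping algebra. -/
noncomputable def ofLie : L →ₗ[K] GenEnveloping 𝔏 ω :=
  (RingQuot.mkAlgHom K (GenEnvelopingRel 𝔏 ω)).toLinearMap ∘ₗ TensorAlgebra.ι K

theorem ofLie_apply (a : L) :
    ofLie 𝔏 ω a = RingQuot.mkAlgHom K (GenEnvelopingRel 𝔏 ω) (TensorAlgebra.ι K a) := rfl

theorem ofLie_relation {g h : G} {a b : L} (ha : a ∈ 𝔏.comp g) (hb : b ∈ 𝔏.comp h) :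
    ofLie 𝔏 ω a * ofLie 𝔏 ω b - (ε g h : K) • (ofLie 𝔏 ω b * ofLie 𝔏 ω a)
      - ofLie 𝔏 ω (𝔏.bracket a b) - algebraMap K _ (ω.form a b) = 0 := by
  have := RingQuot.mkAlgHom_rel K (GenEnvelopingRel.mk (ω := ω) ha hb)
  simpa [ofLie_apply] using this

theorem adjoin_range_ofLie : Algebra.adjoin K (Set.range (ofLie 𝔏 ω)) = ⊤ := by
  have h : Set.range (ofLie 𝔏 ω) =
      RingQuot.mkAlgHom K (GenEnvelopingRel 𝔏 ω) '' Set.range (TensorAlgebra.ι K) := by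
    rw [← Set.range_comp]
    rfl
  rw [h, ← AlgHom.map_adjoin, TensorAlgebra.adjoin_range_ι, Algebra.map_top,
    AlgHom.range_eq_top]
  exact RingQuot.mkAlgHom_surjective K _

theorem exists_skewFamily [FiniteDimensional K L] :
    ∃ (n : ℕ) (x : Fin n → GenEnveloping 𝔏 ω),
      IsSkewFamily K x ∧ Algebra.adjoin K (Set.range x) = ⊤ := by
  let b := 𝔏.isInternal.collectedBasis fun g => Module.Free.chooseBasis K (𝔏.comp g)
  have := Module.Finite.finite_basis b
  obtain ⟨n, ⟨e⟩⟩ := Finite.exists_equiv_fin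
    (Σ g, Module.Free.ChooseBasisIndex K (𝔏.comp g))
  let c := b.reindex e
  have hc : ∀ i, c i ∈ 𝔏.comp (e.symm i).1 := fun i => by
    simpa only [c, Module.Basis.reindex_apply] using
      𝔏.isInternal.collectedBasis_mem _ (e.symm i)
  have hspan : ∀ a, ofLie 𝔏 ω a ∈ Submodule.span K (Set.range fun i => ofLie 𝔏 ω (c i)) := by
    intro a
    have h := Submodule.mem_map_of_mem (f := ofLie 𝔏 ω) (c.mem_span a)
    rwa [Submodule.map_span, ← Set.range_comp] at h
  refine ⟨n, fun i => ofLie 𝔏 ω (c i), fun i j =>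
    ⟨ε (e.symm i).1 (e.symm j).1, Units.ne_zero _, ?_⟩, ?_⟩
  · have h := ofLie_relation 𝔏 ω (hc i) (hc j)
    rw [sub_sub, sub_eq_zero] at h
    rw [h]
    refine add_mem (Submodule.span_mono (Set.subset_insert _ _) (hspan _)) ?_
    rw [Algebra.algebraMap_eq_smul_one]
    exact Submodule.smul_mem _ _ (Submodule.subset_span (Set.mem_insert _ _))
  · rw [eq_top_iff, ← adjoin_range_ofLie 𝔏 ω, Algebra.adjoin_le_iff]
    rintro _ ⟨a, rfl⟩
    exact Algebra.span_le_adjoin K _ (hspan a)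

theorem ofLie_mem {g : G} {a : L} (ha : a ∈ 𝔏.comp g) :
    ofLie 𝔏 ω a ∈ genEnvelopingGrading 𝔏 ω g :=
  Submodule.mem_map_of_mem <| Submodule.subset_span ⟨[(g, a)], by simpa using ha, by simp, by simp⟩

theorem genEnvelopingGrading_eq_span (g : G) :
    genEnvelopingGrading 𝔏 ω g = Submodule.span K {t | ∃ l : List (G × L),
      (∀ p ∈ l, p.2 ∈ 𝔏.comp p.1) ∧ (l.map Prod.fst).sum = g ∧
        t = (l.map fun p => ofLie 𝔏 ω p.2).prod} := by
  rw [genEnvelopingGrading, tensorGrading, Submodule.map_span]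
  congr 1
  ext t
  constructor
  · rintro ⟨_, ⟨l, hl, hg, rfl⟩, rfl⟩
    exact ⟨l, hl, hg, by simp [map_list_prod, ofLie_apply, Function.comp_def]⟩
  · rintro ⟨l, hl, hg, rfl⟩
    exact ⟨_, ⟨l, hl, hg, rfl⟩, by simp [map_list_prod, ofLie_apply, Function.comp_def]⟩

instance gradedMonoid : SetLike.GradedMonoid (genEnvelopingGrading 𝔏 ω) where
  one_mem := by
    rw [genEnvelopingGrading_eq_span]
    exact Submodule.subset_span ⟨[], by simp⟩
  mul_mem g h a b ha hb := by
    have := Submodule.mul_mem_mul ha hb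
    rw [genEnvelopingGrading_eq_span, genEnvelopingGrading_eq_span, Submodule.span_mul_span] at this
    rw [genEnvelopingGrading_eq_span]
    refine Submodule.span_mono ?_ this
    rintro _ ⟨_, ⟨l, hl, rfl, rfl⟩, _, ⟨l', hl', rfl, rfl⟩, rfl⟩
    refine ⟨l ++ l', fun p hp => ?_, by simp, by simp⟩
    exact (List.mem_append.1 hp).elim (hl p) (hl' p)

open DirectSum in
/-- The map `L = ⨁ L_g → ⨁ U_ω(L)_g`. -/
noncomputable def decomposeLie : L →ₗ[K] ⨁ g, genEnvelopingGrading 𝔏 ω g :=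
  (DirectSum.lmap fun g => ((ofLie 𝔏 ω).restrict fun _ ha => ofLie_mem 𝔏 ω ha :
      𝔏.comp g →ₗ[K] genEnvelopingGrading 𝔏 ω g)) ∘ₗ
    (LinearEquiv.ofBijective (DirectSum.coeLinearMap 𝔏.comp) 𝔏.isInternal).symm.toLinearMap

theorem decomposeLie_of_mem {g : G} {a : L} (ha : a ∈ 𝔏.comp g) :
    decomposeLie 𝔏 ω a =
      DirectSum.lof K G (fun g => genEnvelopingGrading 𝔏 ω g) g ⟨_, ofLie_mem 𝔏 ω ha⟩ := by
  have h : (LinearEquiv.ofBijective (DirectSum.coeLinearMap 𝔏.comp) 𝔏.isInternal).symm a =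
      DirectSum.lof K G (fun g => 𝔏.comp g) g ⟨a, ha⟩ := by
    rw [LinearEquiv.symm_apply_eq]
    exact (DirectSum.coeLinearMap_lof 𝔏.comp g ⟨a, ha⟩).symm
  rw [decomposeLie, LinearMap.comp_apply, LinearEquiv.coe_coe, h, DirectSum.lmap_lof]
  rfl

open DirectSum in
theorem decomposeLie_mul {g h : G} {a b : L} (ha : a ∈ 𝔏.comp g) (hb : b ∈ 𝔏.comp h) :
    decomposeLie 𝔏 ω a * decomposeLie 𝔏 ω b =
      (ε g h : K) • (decomposeLie 𝔏 ω b * decomposeLie 𝔏 ω a)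
        + decomposeLie 𝔏 ω (𝔏.bracket a b)
        + algebraMap K (⨁ g, genEnvelopingGrading 𝔏 ω g) (ω.form a b) := by
  rw [decomposeLie_of_mem 𝔏 ω ha, decomposeLie_of_mem 𝔏 ω hb,
    decomposeLie_of_mem 𝔏 ω (𝔏.bracket_mem ha hb)]
  refine DirectSum.lof_mul_lof_eq _ _ _ _ _ _ (ω.degree_zero ha hb) ?_
  have h := ofLie_relation 𝔏 ω ha hb
  rwa [sub_sub, sub_sub, sub_eq_zero, ← add_assoc] at h

open DirectSum in
/-- The decomposition of `U_ω(L)` into its homogeneous components. -/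
noncomputable def decomposeHom : GenEnveloping 𝔏 ω →ₐ[K] ⨁ g, genEnvelopingGrading 𝔏 ω g :=
  RingQuot.liftAlgHom K ⟨TensorAlgebra.lift K (decomposeLie 𝔏 ω), by
    rintro _ _ ⟨ha, hb⟩
    let : Ring (⨁ g, genEnvelopingGrading 𝔏 ω g) :=
      DirectSum.ring (fun g => genEnvelopingGrading 𝔏 ω g)
    refine map_sub_sub_sub_eq (S := ⨁ g, genEnvelopingGrading 𝔏 ω g)
      (TensorAlgebra.lift K (decomposeLie 𝔏 ω)).toRingHom ?_
    simpa using decomposeLie_mul 𝔏 ω ha hb⟩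

theorem decomposeHom_ofLie (a : L) : decomposeHom 𝔏 ω (ofLie 𝔏 ω a) = decomposeLie 𝔏 ω a := by
  simp [decomposeHom, ofLie_apply]

theorem coe_decomposeLie (a : L) :
    DirectSum.coeAlgHom (genEnvelopingGrading 𝔏 ω) (decomposeLie 𝔏 ω a) = ofLie 𝔏 ω a := by
  obtain ⟨a, rfl⟩ := 𝔏.isInternal.surjective a
  induction a using DirectSum.induction_on with
  | zero => simp
  | of g a =>
    rw [DirectSum.coeAddMonoidHom_of, decomposeLie_of_mem 𝔏 ω a.2]
    exact DirectSum.coeAlgHom_of _ _ _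
  | add a b ha hb => simp only [map_add, ha, hb]

/-- Multiplicativity reduces this to single letters; such words span each component, so it
determines `decomposeHom` there. -/
theorem decomposeHom_list_prod (l : List (G × L)) (hl : ∀ p ∈ l, p.2 ∈ 𝔏.comp p.1) :
    ∃ h : (l.map fun p => ofLie 𝔏 ω p.2).prod ∈ genEnvelopingGrading 𝔏 ω (l.map Prod.fst).sum,
      decomposeHom 𝔏 ω (l.map fun p => ofLie 𝔏 ω p.2).prod =
        DirectSum.lof K G (fun g => genEnvelopingGrading 𝔏 ω g) _ ⟨_, h⟩ := by
  induction l with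
  | nil => exact ⟨SetLike.one_mem_graded _, map_one _⟩
  | cons p l ih =>
    obtain ⟨h, e⟩ := ih fun q hq => hl q (List.mem_cons_of_mem _ hq)
    have hp := hl p List.mem_cons_self
    refine ⟨SetLike.mul_mem_graded (ofLie_mem 𝔏 ω hp) h, ?_⟩
    refine (map_mul (decomposeHom 𝔏 ω) _ _).trans ?_
    refine (congrArg₂ _ ((decomposeHom_ofLie 𝔏 ω p.2).trans (decomposeLie_of_mem 𝔏 ω hp)) e).trans ?_
    exact DirectSum.of_mul_of _ _

/-- The two composites are checked on the generators from `L` and on the words spanning each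
component. -/
noncomputable instance gradedAlgebra : GradedAlgebra (genEnvelopingGrading 𝔏 ω) :=
  GradedAlgebra.ofAlgHom _ (decomposeHom 𝔏 ω)
    (by
      ext a
      change DirectSum.coeAlgHom _ (decomposeHom 𝔏 ω (ofLie 𝔏 ω a)) = ofLie 𝔏 ω a
      rw [decomposeHom_ofLie, coe_decomposeLie])
    (by
      rintro g ⟨a, ha⟩
      change decomposeHom 𝔏 ω a =
        DirectSum.lof K G (fun g => genEnvelopingGrading 𝔏 ω g) g ⟨a, ha⟩
      have ha' := ha
      rw [genEnvelopingGrading_eq_span] at ha'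
      induction ha' using Submodule.span_induction with
      | mem a h =>
        obtain ⟨l, hl, rfl, rfl⟩ := h
        exact (decomposeHom_list_prod 𝔏 ω l hl).2
      | zero => rw [map_zero]; exact (map_zero _).symm
      | add a b ha₁ hb₁ iha ihb =>
        rw [← genEnvelopingGrading_eq_span] at ha₁ hb₁
        rw [map_add, iha ha₁, ihb hb₁, ← map_add]
        rfl
      | smul c a ha₁ iha =>
        rw [← genEnvelopingGrading_eq_span] at ha₁
        rw [map_smul, iha ha₁, ← map_smul]
        rfl)

end GenEnveloping

theorem proposition2p4 {K G L : Type*} [Field K] [CharZero K] [AddCommGroup G] [DecidableEq G]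
    [AddCommGroup L] [Module K L] [FiniteDimensional K L]
    (ε : G → G → Kˣ) (hε : IsAntiBicharacter ε)
    (𝔏 : ColorLieAlgebra ε L) (ω : ColorTwoCocycle 𝔏) :
    ∃ _ : GradedAlgebra (genEnvelopingGrading 𝔏 ω),
      IsGradedLeftNoetherian (genEnvelopingGrading 𝔏 ω) ∧
      IsGradedRightNoetherian (genEnvelopingGrading 𝔏 ω) ∧
      IsNoetherianRing (GenEnveloping 𝔏 ω) ∧
      IsNoetherianRing (GenEnveloping 𝔏 ω)ᵐᵒᵖ := by
  obtain ⟨n, x, hx, hgen⟩ := GenEnveloping.exists_skewFamily 𝔏 ω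
  have hleft := hx.isNoetherianRing hgen
  have hright := hx.op.isNoetherianRing (Algebra.adjoin_range_op_eq_top hgen)
  exact ⟨GenEnveloping.gradedAlgebra 𝔏 ω, .of_isNoetherianRing _,
    .of_isNoetherianRing_mulOpposite _, hleft, hright⟩
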